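/- Let $r\ge 0$ and let all parameters $A,A',B,B',C,C',C''$ be matrices in $\mathbb C^{r\times r}$, $I$ the identity. For $k\in\mathbb Z$ let $(A)_k$ be the matrix Pochhammer symbol: $(A)_0=I$, $(A)_n=A(A+I)\cdots(A+(n-1)I)$ and $(A)_{-n}=(-1)^n\,\big((I-A)_n\big)^{-1}$ for $n\ge1$; write $(A)_k^{-1}$ for the inverse of $(A)_k$. For $|t|<1$ put $(1-t)^{-P}=\exp(-P\log(1-t))$ with the principal logarithm. Each of the following functions of $x,y\in\mathbb C$ is a double power series $\sum_{m,n\ge0}c_{m,n}\frac{x^my^n}{m!\,n!}$ with the matrix coefficients $c_{m,n}$ (products in the written order): - $G_2(A,A',B,B';x,y)$: $(A)_m(A')_n(B)_{n-m}(B')_{m-n}$; - $G_3(A,A';x,y)$: $(A)_{2n-m}(A')_{2m-n}$; - $H_1(A,B,C;C';x,y)$: $(A)_{m-n}(B)_{m+n}(C)_n(C')_m^{-1}$; - $H_2(A,B,C,C';C'';x,y)$: $(A)_{m-n}(B)_m(C)_n(C')_n(C'')_m^{-1}$; - $H_3(A,B;C;x,y)$: $(A)_{2m+n}(B)_n(C)_{m+n}^{-1}$;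 - $H_4(A,B;C,C';x,y)$: $(A)_{2m+n}(B)_n(C)_m^{-1}(C')_n^{-1}$; - $H_5(A,B;C;x,y)$: $(A)_{2m+n}(B)_{n-m}(C)_n^{-1}$; - $H_6(A,B;C;x,y)$: $(A)_{2m-n}(B)_{n-m}(C)_n$; - $H_7(A,B;C,C';x,y)$: $(A)_{2m-n}(B)_n(C)_n(C')_m^{-1}$; - $\Gamma_1(A,B,B';x,y)$: $(A)_m(B)_{n-m}(B')_{m-n}$; - $\Gamma_2(B,B';x,y)$: $(B)_{n-m}(B')_{m-n}$; - $\mathcal H_1(A,B;C;x,y)$: $(A)_{m-n}(B)_{m+n}(C)_m^{-1}$; - $\mathcal H_2(A,B,B';C;x,y)$: $(A)_{m-n}(B)_m(B')_n(C)_m^{-1}$; - $\mathcal H_3(A,B;C;x,y)$: $(A)_{m-n}(B)_m(C)_m^{-1}$; - $\mathcal H_4(A,B';C;x,y)$: $(A)_{m-n}(B')_n(C)_m^{-1}$; - $\mathcal H_5(A;C;x,y)$: $(A)_{m-n}(C)_m^{-1}$; - $\mathcal H_6(A;C;x,y)$: $(A)_{2m+n}(C)_{m+n}^{-1}$; - $\mathcal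 H_7(A;C,C';x,y)$: $(A)_{2m+n}(C)_m^{-1}(C')_n^{-1}$; - $\mathcal H_8(A,B;x,y)$: $(A)_{2m-n}(B)_{n-m}$; - $\mathcal H_9(A,B;C;x,y)$: $(A)_{2m-n}(B)_n(C)_m^{-1}$; - $\mathcal H_{10}(A;C;x,y)$: $(A)_{2m-n}(C)_m^{-1}$; - $\mathcal H_{11}(A,B,C;C';x,y)$: $(A)_{m-n}(B)_n(C)_n(C')_m^{-1}$. The domain of convergence of such a series is the open set of the $(x,y)$ for which the series converges absolutely at some $(R,S)$ with $R>|x|$, $S>|y|$. Standing assumptions, which say that all the symbols are defined: a parameter $Q$ that occurs through $(Q)_k^{-1}$ has $Q+kI$ invertible for all integers $k\ge0$; a parameter $Q$ that occurs through a Pochhammer symbol with index $m-n$, $n-m$, $2m-n$ or $2n-m$ has $Q-kI$ invertible for all integers $k\ge1$, and $Q+jI$ invertible for all $j\in\mathbb Z$ in a formula in which $Q$ is shifted to $Q+nI$. For a function $F$, one of its parameters $P$ and integers $a,b$, let $\mathrm L(F,P;a,b)$ be the formula $$(1-t)^{-P}\,F\big(P;\,x(1-t)^a,\,y(1-t)^b\big)=\sum_{n=0}^\infty\frac{(P)_n}{n!}\,F(P+nI;\,x,y)\,t^n,$$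 and let $\mathrm R(F,P;a,b)$ be the formula $$F\big(P;\,x(1-t)^a,\,y(1-t)^b\big)\,(1-t)^{-P}=\sum_{n=0}^\infty F(P+nI;\,x,y)\,\frac{(P)_n}{n!}\,t^n,$$ the other parameters being fixed. Each is asserted for all $x,y,t\in\mathbb C$ with $|t|<1$ such that $(x(1-s)^a,y(1-s)^b)$ lies in the domain of convergence of $F(P)$ whenever $|s|\le|t|$ and, for those $n$ (if any) for which $(P)_n$ is singular, $(x,y)$ lies in the domain of convergence of $F(P+nI)$. It is part of the assertion that then $(x,y)$ lies in the domain of convergence of $F(P+nI)$ for every $n\ge 0$ and that the series over $n$ converges. The following formulae hold, each under the commutativity stated with it. - $\mathrm L(G_2,A;-1,0)$; $\mathrm L(G_2,A';0,-1)$ if $AA'=A'A$; $\mathrm R(G_2,B;1,-1)$ if $BB'=B'B$; $\mathrm R(G_2,B';-1,1)$. - $\mathrm L(G_3,A;1,-2)$; $\mathrm R(G_3,A';-2,1)$. - $\mathrm L(H_1,A;-1,1)$; $\mathrm L(H_1,B;-1,-1)$ if $AB=BA$; $\mathrm R(H_1,C;0,-1)$ if $CC'=C'C$. - $\mathrm L(H_2,A;-1,1)$;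 $\mathrm L(H_2,B;-1,0)$ if $AB=BA$; $\mathrm R(H_2,C;0,-1)$ if $CC'=C'C$ and $CC''=C''C$; $\mathrm R(H_2,C';0,-1)$ if $C'C''=C''C'$. - $\mathrm L(H_3,A;-2,-1)$; $\mathrm L(H_3,B;0,-1)$ if $AB=BA$. - $\mathrm L(H_4,A;-2,-1)$; $\mathrm L(H_4,B;0,-1)$ if $AB=BA$. - $\mathrm L(H_5,A;-2,-1)$; $\mathrm L(H_5,B;1,-1)$ if $AB=BA$. - $\mathrm L(H_6,A;-2,1)$; $\mathrm L(H_6,B;1,-1)$ if $AB=BA$. - $\mathrm L(H_7,A;-2,1)$; $\mathrm L(H_7,B;0,-1)$ if $AB=BA$; $\mathrm R(H_7,C;0,-1)$ if $CC'=C'C$. - $\mathrm L(\Gamma_1,A;-1,0)$; $\mathrm R(\Gamma_1,B;1,-1)$ if $BB'=B'B$; $\mathrm R(\Gamma_1,B';-1,1)$. - $\mathrm L(\Gamma_2,B;1,-1)$; $\mathrm R(\Gamma_2,B';-1,1)$. - $\mathrm L(\mathcal H_1,A;-1,1)$; $\mathrm L(\mathcal H_1,B;-1,-1)$ if $AB=BA$.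 - $\mathrm L(\mathcal H_2,A;-1,1)$; $\mathrm L(\mathcal H_2,B;-1,0)$ if $AB=BA$; $\mathrm R(\mathcal H_2,B';0,-1)$ if $B'C=CB'$. - $\mathrm L(\mathcal H_3,A;-1,1)$; $\mathrm L(\mathcal H_3,B;-1,0)$ if $AB=BA$. - $\mathrm L(\mathcal H_4,A;-1,1)$; $\mathrm L(\mathcal H_4,B';0,-1)$ if $AB'=B'A$. - $\mathrm L(\mathcal H_5,A;-1,1)$. - $\mathrm L(\mathcal H_6,A;-2,-1)$. - $\mathrm L(\mathcal H_7,A;-2,-1)$. - $\mathrm L(\mathcal H_8,A;-2,1)$; $\mathrm R(\mathcal H_8,B;1,-1)$. - $\mathrm L(\mathcal H_9,A;-2,1)$; $\mathrm L(\mathcal H_9,B;0,-1)$ if $AB=BA$. - $\mathrm L(\mathcal H_{10},A;-2,1)$. - $\mathrm L(\mathcal H_{11},A;-1,1)$; $\mathrm L(\mathcal H_{11},B;0,-1)$ if $AB=BA$; $\mathrm R(\mathcal H_{11},C;0,-1)$ if $CC'=C'C$. -/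

import Mathlib

open scoped Nat

namespace HornMatrix

/-- Square complex matrices of size `r`. -/
abbrev Mat (r : ℕ) : Type := Matrix (Fin r) (Fin r) ℂ

/-- The matrix Pochhammer symbol `(A)_k` for `k ∈ ℤ`:
`(A)_n = A (A + I) ⋯ (A + (n-1) I)` for `n ≥ 0`, and `(A)_{-n} = (-1)^n ((I - A)_n)⁻¹` for `n ≥ 1`. -/
noncomputable def poch {r : ℕ} (A : Mat r) : ℤ → Mat r
  | Int.ofNat n => Polynomial.aeval A (ascPochhammer ℂ n)
  | Int.negSucc n =>
      ((-1 : ℂ) ^ (n + 1)) • (Polynomial.aeval (1 - A) (ascPochhammer ℂ (n + 1)))⁻¹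

theorem poch_zero {r : ℕ} (A : Mat r) : poch A 0 = 1 := by
  change Polynomial.aeval A (ascPochhammer ℂ 0) = 1
  simp

theorem poch_succ {r : ℕ} (A : Mat r) (n : ℕ) :
    poch A ((n + 1 : ℕ) : ℤ) = poch A (n : ℤ) * (A + (n : ℂ) • (1 : Mat r)) := by
  change Polynomial.aeval A (ascPochhammer ℂ (n + 1)) =
    Polynomial.aeval A (ascPochhammer ℂ n) * _
  rw [ascPochhammer_succ_right, map_mul, map_add, Polynomial.aeval_X, map_natCast]
  congr 2
  rw [← nsmul_one, ← Nat.cast_smul_eq_nsmul ℂ]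

/-- `C + k I` is invertible for every integer `k ≥ 0`, so that every `(C)_k`, `k ≥ 0`,
is invertible. -/
def NonnegRegular {r : ℕ} (C : Mat r) : Prop :=
  ∀ k : ℕ, IsUnit (C + (k : ℂ) • (1 : Mat r))

/-- `A - k I` is invertible for every integer `k ≥ 1`: exactly what is needed for `(A)_{-k}`,
`k ≥ 1`, to make sense. -/
def NegRegular {r : ℕ} (A : Mat r) : Prop :=
  ∀ k : ℕ, 1 ≤ k → IsUnit (A - (k : ℂ) • (1 : Mat r))

/-- `P + j I` is invertible for every integer `j`: exactly what is needed for `(P + n I)_{-k}`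
to make sense for all `n ≥ 0` and `k ≥ 1`. -/
def IntRegular {r : ℕ} (P : Mat r) : Prop :=
  ∀ j : ℤ, IsUnit (P + (j : ℂ) • (1 : Mat r))

/-- The double power series `∑_{m,n ≥ 0} c m n * x^m y^n / (m! n!)` with matrix coefficients,
given by its array `c`. -/
def DoubleSeries (r : ℕ) : Type := ℕ → ℕ → Mat r

/-- The sum of the double power series at `(x, y)`. -/
noncomputable def DoubleSeries.eval {r : ℕ} (c : DoubleSeries r) (x y : ℂ) : Mat r :=
  ∑' p : ℕ × ℕ, (x ^ p.1 * y ^ p.2 / ((p.1 ! : ℂ) * (p.2 ! : ℂ))) • c p.1 p.2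

/-- The (open) domain of convergence of the double power series: the points `(x, y)` for which the
series converges absolutely at some `(R, S)` with `|x| < R` and `|y| < S`. -/
def DoubleSeries.domain {r : ℕ} (c : DoubleSeries r) : Set (ℂ × ℂ) :=
  {z | ∃ R S : ℝ, ‖z.1‖ < R ∧ ‖z.2‖ < S ∧ ∀ i j : Fin r,
    Summable fun p : ℕ × ℕ => R ^ p.1 * S ^ p.2 / ((p.1 ! : ℝ) * (p.2 ! : ℝ)) * ‖c p.1 p.2 i j‖}

section Functions

variable {r : ℕ}

/-- `G₂(A, A', B, B'; x, y)`. -/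
noncomputable def G2 (A A' B B' : Mat r) : DoubleSeries r := fun m n =>
  poch A m * poch A' n * poch B ((n : ℤ) - m) * poch B' ((m : ℤ) - n)

/-- `G₃(A, A'; x, y)`. -/
noncomputable def G3 (A A' : Mat r) : DoubleSeries r := fun m n =>
  poch A (2 * (n : ℤ) - m) * poch A' (2 * (m : ℤ) - n)

/-- `H₁(A, B, C; C'; x, y)`. -/
noncomputable def H1 (A B C C' : Mat r) : DoubleSeries r := fun m n =>
  poch A ((m : ℤ) - n) * poch B ((m : ℤ) + n) * poch C n * (poch C' m)⁻¹

/-- `H₂(A, B, C, C'; C''; x, y)`. -/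
noncomputable def H2 (A B C C' C'' : Mat r) : DoubleSeries r := fun m n =>
  poch A ((m : ℤ) - n) * poch B m * poch C n * poch C' n * (poch C'' m)⁻¹

/-- `H₃(A, B; C; x, y)`. -/
noncomputable def H3 (A B C : Mat r) : DoubleSeries r := fun m n =>
  poch A (2 * (m : ℤ) + n) * poch B n * (poch C ((m : ℤ) + n))⁻¹

/-- `H₄(A, B; C, C'; x, y)`. -/
noncomputable def H4 (A B C C' : Mat r) : DoubleSeries r := fun m n =>
  poch A (2 * (m : ℤ) + n) * poch B n * (poch C m)⁻¹ * (poch C' n)⁻¹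

/-- `H₅(A, B; C; x, y)`. -/
noncomputable def H5 (A B C : Mat r) : DoubleSeries r := fun m n =>
  poch A (2 * (m : ℤ) + n) * poch B ((n : ℤ) - m) * (poch C n)⁻¹

/-- `H₆(A, B; C; x, y)`. -/
noncomputable def H6 (A B C : Mat r) : DoubleSeries r := fun m n =>
  poch A (2 * (m : ℤ) - n) * poch B ((n : ℤ) - m) * poch C n

/-- `H₇(A, B; C, C'; x, y)`. -/
noncomputable def H7 (A B C C' : Mat r) : DoubleSeries r := fun m n =>
  poch A (2 * (m : ℤ) - n) * poch B n * poch C n * (poch C' m)⁻¹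

/-- `Γ₁(A, B, B'; x, y)`. -/
noncomputable def Gamma1 (A B B' : Mat r) : DoubleSeries r := fun m n =>
  poch A m * poch B ((n : ℤ) - m) * poch B' ((m : ℤ) - n)

/-- `Γ₂(B, B'; x, y)`. -/
noncomputable def Gamma2 (B B' : Mat r) : DoubleSeries r := fun m n =>
  poch B ((n : ℤ) - m) * poch B' ((m : ℤ) - n)

/-- `ℋ₁(A, B; C; x, y)`. -/
noncomputable def calH1 (A B C : Mat r) : DoubleSeries r := fun m n =>
  poch A ((m : ℤ) - n) * poch B ((m : ℤ) + n) * (poch C m)⁻¹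

/-- `ℋ₂(A, B, B'; C; x, y)`. -/
noncomputable def calH2 (A B B' C : Mat r) : DoubleSeries r := fun m n =>
  poch A ((m : ℤ) - n) * poch B m * poch B' n * (poch C m)⁻¹

/-- `ℋ₃(A, B; C; x, y)`. -/
noncomputable def calH3 (A B C : Mat r) : DoubleSeries r := fun m n =>
  poch A ((m : ℤ) - n) * poch B m * (poch C m)⁻¹

/-- `ℋ₄(A, B'; C; x, y)`. -/
noncomputable def calH4 (A B' C : Mat r) : DoubleSeries r := fun m n =>
  poch A ((m : ℤ) - n) * poch B' n * (poch C m)⁻¹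

/-- `ℋ₅(A; C; x, y)`. -/
noncomputable def calH5 (A C : Mat r) : DoubleSeries r := fun m n =>
  poch A ((m : ℤ) - n) * (poch C m)⁻¹

/-- `ℋ₆(A; C; x, y)`. -/
noncomputable def calH6 (A C : Mat r) : DoubleSeries r := fun m n =>
  poch A (2 * (m : ℤ) + n) * (poch C ((m : ℤ) + n))⁻¹

/-- `ℋ₇(A; C, C'; x, y)`. -/
noncomputable def calH7 (A C C' : Mat r) : DoubleSeries r := fun m n =>
  poch A (2 * (m : ℤ) + n) * (poch C m)⁻¹ * (poch C' n)⁻¹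

/-- `ℋ₈(A, B; x, y)`. -/
noncomputable def calH8 (A B : Mat r) : DoubleSeries r := fun m n =>
  poch A (2 * (m : ℤ) - n) * poch B ((n : ℤ) - m)

/-- `ℋ₉(A, B; C; x, y)`. -/
noncomputable def calH9 (A B C : Mat r) : DoubleSeries r := fun m n =>
  poch A (2 * (m : ℤ) - n) * poch B n * (poch C m)⁻¹

/-- `ℋ₁₀(A; C; x, y)`. -/
noncomputable def calH10 (A C : Mat r) : DoubleSeries r := fun m n =>
  poch A (2 * (m : ℤ) - n) * (poch C m)⁻¹

/-- `ℋ₁₁(A, B, C; C'; x, y)`. -/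
noncomputable def calH11 (A B C C' : Mat r) : DoubleSeries r := fun m n =>
  poch A ((m : ℤ) - n) * poch B n * poch C n * (poch C' m)⁻¹

end Functions

/-- `(1 - t)^{-P} = exp (-P log (1 - t))`, with the principal logarithm. -/
noncomputable def oneSubPowNeg {r : ℕ} (t : ℂ) (P : Mat r) : Mat r :=
  NormedSpace.exp ((-Complex.log (1 - t)) • P)

/-- The arguments are admissible for the summation formula in the parameter `P` of the matrix
function `F`, with rescaled arguments `x (1 - t)^a` and `y (1 - t)^b`: `|t| < 1`, the arguments
rescaled by any `s` in the disc `|s| ≤ |t|` lie in the domain of convergence of `F(P)`, and, in the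
degenerate case that some `(P)_n` is singular, `(x, y)` lies in the domain of convergence of
`F(P + nI)` for these `n`. -/
def Admissible {r : ℕ} (F : Mat r → DoubleSeries r) (P : Mat r) (a b : ℤ) (x y t : ℂ) : Prop :=
  ‖t‖ < 1 ∧
  (∀ s : ℂ, ‖s‖ ≤ ‖t‖ → (x * (1 - s) ^ a, y * (1 - s) ^ b) ∈ (F P).domain) ∧
  (∀ n : ℕ, ¬ IsUnit (poch P n) → (x, y) ∈ (F (P + (n : ℂ) • (1 : Mat r))).domain)

/-- `(1 - t)^{-P} F(P; x (1 - t)^a, y (1 - t)^b) = ∑_n (P)_n / n! * F(P + nI; x, y) t^n`,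
where all the series converge. -/
def LeftFormula {r : ℕ} (F : Mat r → DoubleSeries r) (P : Mat r) (a b : ℤ) : Prop :=
  ∀ x y t : ℂ, Admissible F P a b x y t →
    (∀ n : ℕ, (x, y) ∈ (F (P + (n : ℂ) • (1 : Mat r))).domain) ∧
    HasSum
      (fun n : ℕ => (t ^ n / (n ! : ℂ)) •
        (poch P n * (F (P + (n : ℂ) • (1 : Mat r))).eval x y))
      (oneSubPowNeg t P * (F P).eval (x * (1 - t) ^ a) (y * (1 - t) ^ b))

/-- `F(P; x (1 - t)^a, y (1 - t)^b) (1 - t)^{-P} = ∑_n F(P + nI; x, y) * (P)_n / n! t^n`,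
where all the series converge. -/
def RightFormula {r : ℕ} (F : Mat r → DoubleSeries r) (P : Mat r) (a b : ℤ) : Prop :=
  ∀ x y t : ℂ, Admissible F P a b x y t →
    (∀ n : ℕ, (x, y) ∈ (F (P + (n : ℂ) • (1 : Mat r))).domain) ∧
    HasSum
      (fun n : ℕ => (t ^ n / (n ! : ℂ)) •
        ((F (P + (n : ℂ) • (1 : Mat r))).eval x y * poch P n))
      ((F P).eval (x * (1 - t) ^ a) (y * (1 - t) ^ b) * oneSubPowNeg t P)

end HornMatrix

open HornMatrix

/-! Each series depends on the distinguished parameter `P` through one factor: under the stated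
commutativity its coefficients are `(P)_k D` (or `D (P)_k`), with `k = -(am + bn)` and `D` unchanged
when `P` is shifted by a multiple of the identity. The algebraic core is `(P)_N (P + N)_k = (P +
k)_N (P)_k` (`rising_mul_poch_shift`). It turns the sum over `N` into the binomial series of `P +
k`, which equals `(1 - t)^{-k} (1 - t)^{-P}`; the scalar `(1 - t)^{am + bn}` is exactly the
rescaling of `x` and `y`.

The analytic core is the interchange of the sums over `N` and over `(m, n)` (`hasSum_shift`). Taking
norms in the contiguous relation between `(P)_n` and `(P + 1)_n` bounds the absolute binomial series
of `P + k`, at `τ = |t|`, by a constant times `(1 - τ)^{-k} + (1 + τ)^{-k}`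
(`tsum_absTerm_add_int_le`). The triple series is thus dominated by the double series at the points
rescaled by `s = |t|` and `s = -|t|`, both admissible.

The same bound, for small `τ`, controls `(P + k)_N` for fixed `N`. Where `(P)_N` is invertible, the
coefficients for `P + N` are `(P)_N⁻¹ (P + k)_N` applied to those for `P`, and the room left by the
open domain absorbs the growth (`mem_domain_of_le`). `shift_formula` combines these for left and
right multiplication at once. -/

namespace HornMatrix

/-! ### Algebra of rising factorials -/

section Rising

variable {R : Type*} [Ring R] [Algebra ℂ R]

/-- The rising factorial `P (P + 1) ⋯ (P + (n - 1))` in a complex algebra. -/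
noncomputable def rising (P : R) (n : ℕ) : R := Polynomial.aeval P (ascPochhammer ℂ n)

@[simp]
theorem rising_zero (P : R) : rising P 0 = 1 := by simp [rising]

theorem rising_succ (P : R) (n : ℕ) :
    rising P (n + 1) = rising P n * (P + (n : ℂ) • (1 : R)) := by
  rw [rising, ascPochhammer_succ_right, map_mul, map_add, Polynomial.aeval_X, map_natCast, rising,
    ← nsmul_one, ← Nat.cast_smul_eq_nsmul ℂ]

theorem rising_add (P : R) (m n : ℕ) :
    rising P (m + n) = rising P m * rising (P + (m : ℂ) • (1 : R)) n := by
  induction n with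
  | zero => simp
  | succ n ih =>
    rw [← add_assoc, rising_succ, ih, rising_succ, mul_assoc]
    congr 2
    push_cast
    module

theorem commute_rising {P X : R} (h : Commute P X) (n : ℕ) : Commute (rising P n) X := by
  induction n with
  | zero => simp
  | succ n ih =>
    rw [rising_succ]
    exact ih.mul_left (h.add_left ((Commute.one_left X).smul_left _))

/-- Both rising factorials of length `n + 1` contain `(P + 1)_n`; the remaining factors `P` and `P +
n + 1` differ by `n + 1`. This is the coefficient form of `(1 - t)^{-P} = (1 - t) (1 - t)^{-(P +
1)}`. -/
theorem rising_shift_succ (P : R) (n : ℕ) :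
    rising (P + 1) (n + 1) = rising P (n + 1) + ((n : ℂ) + 1) • rising (P + 1) n := by
  have h1 : rising P (n + 1) = P * rising (P + 1) n := by
    have := rising_add P 1 n
    rw [add_comm 1 n] at this
    rw [this, rising_succ]
    simp
  have h2 : Commute (rising (P + 1) n) P :=
    commute_rising ((Commute.refl P).add_left (Commute.one_left P)) n
  rw [h1, rising_succ, ← h2.eq, mul_add, mul_add, mul_smul_comm, mul_one]
  module

theorem isUnit_rising {P : R} (n : ℕ) (h : ∀ i < n, IsUnit (P + (i : ℂ) • (1 : R))) :
    IsUnit (rising P n) := by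
  induction n with
  | zero => simp
  | succ n ih =>
    rw [rising_succ]
    exact (ih fun i hi => h i (hi.trans n.lt_succ_self)).mul (h n n.lt_succ_self)

/-- Negate each factor and reverse their order. This exhibits `(P)_{-n}` as the inverse of an
ordinary rising factorial starting at `P - n`. -/
theorem rising_one_sub (P : R) (n : ℕ) :
    ((-1 : ℂ) ^ n) • rising (1 - P) n = rising (P - (n : ℂ) • (1 : R)) n := by
  induction n with
  | zero => simp
  | succ n ih =>
    have h1 := rising_add (P - ((n + 1 : ℕ) : ℂ) • (1 : R)) 1 n
    have h2 : P - ((n + 1 : ℕ) : ℂ) • (1 : R) + ((1 : ℕ) : ℂ) • (1 : R) =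
        P - (n : ℂ) • (1 : R) := by
      push_cast
      module
    have h3 : Commute (P - (n : ℂ) • (1 : R)) (P - ((n + 1 : ℕ) : ℂ) • (1 : R)) := by
      refine Commute.sub_left (Commute.sub_right (Commute.refl P) ?_) ?_
      · exact (Commute.one_right P).smul_right _
      · exact (Commute.one_left _).smul_left _
    rw [add_comm 1 n, h2] at h1
    have h4 : rising (P - ((n + 1 : ℕ) : ℂ) • (1 : R)) 1 = P - ((n + 1 : ℕ) : ℂ) • (1 : R) := by
      simp [rising_succ]
    rw [h1, h4, rising_succ (1 - P), ← (commute_rising h3 n).eq, ← ih, pow_succ, mul_neg_one,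
      neg_smul, ← smul_neg, ← mul_neg, smul_mul_assoc]
    congr 2
    push_cast
    module

end Rising

/-! ### The binomial series in a Banach algebra -/

section Banach

variable {𝔸 : Type*} [NormedRing 𝔸] [NormedAlgebra ℂ 𝔸]

theorem norm_rising_succ_le (P : 𝔸) (n : ℕ) :
    ‖rising P (n + 1)‖ ≤ (‖P‖ + n) * ‖rising P n‖ := by
  rw [rising_succ, mul_add, mul_smul_comm, mul_one]
  calc _ ≤ ‖rising P n * P‖ + ‖(n : ℂ) • rising P n‖ := norm_add_le _ _
    _ ≤ ‖rising P n‖ * ‖P‖ + n * ‖rising P n‖ := by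
        gcongr
        · exact norm_mul_le _ _
        · rw [norm_smul, Complex.norm_natCast]
    _ = _ := by ring

/-- The terms of the absolute binomial series of `(1 - τ)^{-P}`. -/
noncomputable def absTerm (P : 𝔸) (τ : ℝ) (n : ℕ) : ℝ := τ ^ n / (n ! : ℝ) * ‖rising P n‖

theorem absTerm_nonneg (P : 𝔸) {τ : ℝ} (h : 0 ≤ τ) (n : ℕ) : 0 ≤ absTerm P τ n := by
  unfold absTerm; positivity

theorem summable_absTerm (P : 𝔸) {τ : ℝ} (h0 : 0 ≤ τ) (h1 : τ < 1) :
    Summable (absTerm P τ) := by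
  obtain ⟨ρ, hρ, hρ1⟩ := exists_between h1
  refine summable_of_ratio_norm_eventually_le hρ1 ?_
  -- Beyond this threshold `τ (‖P‖ + n) ≤ ρ n`, so the ratio of successive terms is at most `ρ`.
  have hev : ∀ᶠ n : ℕ in Filter.atTop, τ * ‖P‖ / (ρ - τ) ≤ n :=
    tendsto_natCast_atTop_atTop.eventually_ge_atTop _
  filter_upwards [hev] with n hn
  rw [div_le_iff₀ (by linarith)] at hn
  rw [Real.norm_of_nonneg (absTerm_nonneg P h0 _), Real.norm_of_nonneg (absTerm_nonneg P h0 _)]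
  unfold absTerm
  calc τ ^ (n + 1) / ((n + 1)! : ℝ) * ‖rising P (n + 1)‖
      ≤ τ ^ (n + 1) / ((n + 1)! : ℝ) * ((‖P‖ + n) * ‖rising P n‖) := by
        gcongr
        exact norm_rising_succ_le P n
    _ = (τ * (‖P‖ + n) / (n + 1)) * (τ ^ n / (n ! : ℝ) * ‖rising P n‖) := by
        rw [Nat.factorial_succ]; push_cast; field_simp; ring
    _ ≤ ρ * (τ ^ n / (n ! : ℝ) * ‖rising P n‖) := by
        gcongr
        rw [div_le_iff₀ (by positivity)]
        nlinarith

theorem absTerm_zero (P : 𝔸) (τ : ℝ) : absTerm P τ 0 = ‖(1 : 𝔸)‖ := by simp [absTerm]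

theorem absTerm_le_succ (P : 𝔸) {τ : ℝ} (h : 0 ≤ τ) (n : ℕ) :
    absTerm P τ (n + 1) ≤ absTerm (P + 1) τ (n + 1) + τ * absTerm (P + 1) τ n := by
  have h1 : ‖rising P (n + 1)‖ ≤ ‖rising (P + 1) (n + 1)‖ + (n + 1) * ‖rising (P + 1) n‖ := by
    rw [eq_sub_of_add_eq (rising_shift_succ P n).symm]
    refine (norm_sub_le _ _).trans_eq ?_
    rw [norm_smul]
    norm_cast
  calc absTerm P τ (n + 1) ≤ τ ^ (n + 1) / ((n + 1)! : ℝ) *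
        (‖rising (P + 1) (n + 1)‖ + (n + 1) * ‖rising (P + 1) n‖) := by unfold absTerm; gcongr
    _ = _ := by unfold absTerm; rw [Nat.factorial_succ]; push_cast; field_simp; ring

theorem absTerm_succ_le (P : 𝔸) {τ : ℝ} (h : 0 ≤ τ) (n : ℕ) :
    absTerm (P + 1) τ (n + 1) ≤ absTerm P τ (n + 1) + τ * absTerm (P + 1) τ n := by
  have h1 : ‖rising (P + 1) (n + 1)‖ ≤ ‖rising P (n + 1)‖ + (n + 1) * ‖rising (P + 1) n‖ := by
    rw [rising_shift_succ P n]
    refine (norm_add_le _ _).trans_eq ?_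
    rw [norm_smul]
    norm_cast
  calc absTerm (P + 1) τ (n + 1) ≤ τ ^ (n + 1) / ((n + 1)! : ℝ) *
        (‖rising P (n + 1)‖ + (n + 1) * ‖rising (P + 1) n‖) := by unfold absTerm; gcongr
    _ = _ := by unfold absTerm; rw [Nat.factorial_succ]; push_cast; field_simp; ring

/-- Summing the termwise contiguous inequality; the constant terms `‖1‖` agree. The exact factor `1
- t` becomes `1 + τ` under the triangle inequality. -/
theorem tsum_absTerm_le_succ (P : 𝔸) {τ : ℝ} (h0 : 0 ≤ τ) (h1 : τ < 1) :
    ∑' n, absTerm P τ n ≤ (1 + τ) * ∑' n, absTerm (P + 1) τ n := by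
  have s := summable_absTerm P h0 h1
  have s' := summable_absTerm (P + 1) h0 h1
  have e : ∑' n, absTerm P τ (n + 1) ≤
      ∑' n, (absTerm (P + 1) τ (n + 1) + τ * absTerm (P + 1) τ n) :=
    ((summable_nat_add_iff 1).2 s).tsum_le_tsum (absTerm_le_succ P h0)
      (((summable_nat_add_iff 1).2 s').add (s'.mul_left τ))
  rw [((summable_nat_add_iff 1).2 s').tsum_add (s'.mul_left τ), tsum_mul_left] at e
  have e1 := s.tsum_eq_zero_add
  have e2 := s'.tsum_eq_zero_add
  rw [absTerm_zero] at e1 e2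
  linarith

/-- The same relation solved for the terms of `P + 1`: the contribution with factor `τ` is absorbed
on the left, which leaves `1 - τ`. -/
theorem tsum_absTerm_succ_le (P : 𝔸) {τ : ℝ} (h0 : 0 ≤ τ) (h1 : τ < 1) :
    (1 - τ) * ∑' n, absTerm (P + 1) τ n ≤ ∑' n, absTerm P τ n := by
  have s := summable_absTerm P h0 h1
  have s' := summable_absTerm (P + 1) h0 h1
  have e : ∑' n, absTerm (P + 1) τ (n + 1) ≤
      ∑' n, (absTerm P τ (n + 1) + τ * absTerm (P + 1) τ n) :=
    ((summable_nat_add_iff 1).2 s').tsum_le_tsum (absTerm_succ_le P h0)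
      (((summable_nat_add_iff 1).2 s).add (s'.mul_left τ))
  rw [((summable_nat_add_iff 1).2 s).tsum_add (s'.mul_left τ), tsum_mul_left] at e
  have e1 := s.tsum_eq_zero_add
  have e2 := s'.tsum_eq_zero_add
  rw [absTerm_zero] at e1 e2
  linarith

theorem tsum_absTerm_add_nat_le (P : 𝔸) {τ : ℝ} (h0 : 0 ≤ τ) (h1 : τ < 1) (k : ℕ) :
    ∑' n, absTerm (P + (k : ℂ) • (1 : 𝔸)) τ n ≤ (1 - τ) ^ (-(k : ℤ)) * ∑' n, absTerm P τ n := by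
  have hτ : 0 < 1 - τ := by linarith
  induction k with
  | zero => simp
  | succ k ih =>
    have h := tsum_absTerm_succ_le (P + (k : ℂ) • (1 : 𝔸)) h0 h1
    have e : P + (k : ℂ) • (1 : 𝔸) + 1 = P + ((k + 1 : ℕ) : ℂ) • (1 : 𝔸) := by
      push_cast; module
    rw [e] at h
    rw [zpow_neg, zpow_natCast] at ih ⊢
    rw [pow_succ, mul_inv, mul_comm _ (1 - τ)⁻¹, mul_assoc, ← div_eq_inv_mul, le_div_iff₀ hτ]
    linarith

theorem tsum_absTerm_sub_nat_le (P : 𝔸) {τ : ℝ} (h0 : 0 ≤ τ) (h1 : τ < 1) (k : ℕ) :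
    ∑' n, absTerm (P - (k : ℂ) • (1 : 𝔸)) τ n ≤ (1 + τ) ^ k * ∑' n, absTerm P τ n := by
  induction k with
  | zero => simp
  | succ k ih =>
    have h := tsum_absTerm_le_succ (P - ((k + 1 : ℕ) : ℂ) • (1 : 𝔸)) h0 h1
    have e : P - ((k + 1 : ℕ) : ℂ) • (1 : 𝔸) + 1 = P - (k : ℂ) • (1 : 𝔸) := by
      push_cast; module
    rw [e] at h
    calc _ ≤ _ := h
      _ ≤ (1 + τ) * ((1 + τ) ^ k * ∑' n, absTerm P τ n) := by gcongr
      _ = _ := by ring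

/-- The absolute binomial series of an integer shift of `P` is at most a multiple of one of
`(1 ∓ τ)^{-k}`. -/
theorem tsum_absTerm_add_int_le (P : 𝔸) {τ : ℝ} (h0 : 0 ≤ τ) (h1 : τ < 1) (k : ℤ) :
    ∑' n, absTerm (P + (k : ℂ) • (1 : 𝔸)) τ n ≤
      ((1 - τ) ^ (-k) + (1 + τ) ^ (-k)) * ∑' n, absTerm P τ n := by
  have hτ : 0 < 1 - τ := by linarith
  have hS : 0 ≤ ∑' n, absTerm P τ n := tsum_nonneg (absTerm_nonneg P h0)
  -- For `k ≥ 0` the first power suffices, for `k ≤ 0` the second; their sum serves both signs.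
  rcases Int.eq_nat_or_neg k with ⟨n, rfl | rfl⟩
  · have := tsum_absTerm_add_nat_le P h0 h1 n
    rw [add_mul]
    rw [Int.cast_natCast]
    exact this.trans (le_add_of_nonneg_right (by positivity))
  · have := tsum_absTerm_sub_nat_le P h0 h1 n
    rw [add_mul, neg_neg, Int.cast_neg, Int.cast_natCast, neg_smul, ← sub_eq_add_neg, zpow_natCast,
      zpow_natCast]
    exact this.trans (le_add_of_nonneg_left (by positivity))

theorem summable_rising [CompleteSpace 𝔸] (P : 𝔸) {t : ℂ} (ht : ‖t‖ < 1) :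
    Summable fun n : ℕ => (t ^ n / (n ! : ℂ)) • rising P n := by
  refine Summable.of_norm ((summable_absTerm P (norm_nonneg t) ht).congr fun n => ?_)
  simp [absTerm, norm_smul]

variable [CompleteSpace 𝔸]

/-- The binomial series `∑ (P)_n t^n / n!`. -/
noncomputable def binomSeries (t : ℂ) (P : 𝔸) : 𝔸 := ∑' n : ℕ, (t ^ n / (n ! : ℂ)) • rising P n

theorem binomSeries_eq_succ (P : 𝔸) {t : ℂ} (ht : ‖t‖ < 1) :
    binomSeries t P = (1 - t) • binomSeries t (P + 1) := by
  have s := summable_rising P ht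
  have s' := summable_rising (P + 1) ht
  have e : ∑' n : ℕ, (t ^ (n + 1) / ((n + 1)! : ℂ)) • rising (P + 1) (n + 1) =
      ∑' n : ℕ, ((t ^ (n + 1) / ((n + 1)! : ℂ)) • rising P (n + 1) +
        t • ((t ^ n / (n ! : ℂ)) • rising (P + 1) n)) := by
    refine tsum_congr fun n => ?_
    rw [rising_shift_succ, smul_add, smul_smul, smul_smul]
    congr 2
    rw [Nat.factorial_succ]
    have : (n : ℂ) + 1 ≠ 0 := by exact_mod_cast n.succ_ne_zero
    have : (n ! : ℂ) ≠ 0 := by exact_mod_cast n.factorial_ne_zero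
    push_cast
    field_simp
    ring
  rw [((summable_nat_add_iff 1).2 s).tsum_add (s'.const_smul t), s'.tsum_const_smul] at e
  have e1 := s.tsum_eq_zero_add
  have e2 := s'.tsum_eq_zero_add
  unfold binomSeries
  rw [sub_smul, one_smul, eq_sub_iff_add_eq, e1]
  nth_rewrite 2 [e2]
  rw [e]
  simp [add_assoc]

/-- The one-step relation is iterated in both directions, which is possible because `1 - t` is
nonzero. -/
theorem binomSeries_add_int (P : 𝔸) {t : ℂ} (ht : ‖t‖ < 1) (k : ℤ) :
    binomSeries t (P + (k : ℂ) • (1 : 𝔸)) = (1 - t) ^ (-k) • binomSeries t P := by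
  have h1 : (1 - t) ≠ 0 := by
    intro h
    rw [sub_eq_zero] at h
    simp [← h] at ht
  have step (k : ℤ) : binomSeries t (P + (k : ℂ) • (1 : 𝔸)) =
      (1 - t) • binomSeries t (P + ((k + 1 : ℤ) : ℂ) • (1 : 𝔸)) := by
    rw [binomSeries_eq_succ _ ht]
    congr 2
    push_cast
    module
  induction k using Int.induction_on with
  | zero => simp
  | succ k ih =>
    have h := step k
    rw [ih] at h
    rw [← inv_smul_eq_iff₀ h1] at h
    rw [← h, smul_smul, neg_add, zpow_add₀ h1, zpow_neg_one, mul_comm]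
  | pred k ih =>
    rw [step, sub_add_cancel, ih, smul_smul, neg_sub, ← zpow_one_add₀ h1]
    congr 2

theorem hasDerivAt_exp_log (P : 𝔸) {t : ℂ} (ht : ‖t‖ < 1) :
    HasDerivAt (fun t : ℂ => NormedSpace.exp ((-Complex.log (1 - t)) • P))
      ((1 - t)⁻¹ • (P * NormedSpace.exp ((-Complex.log (1 - t)) • P))) t := by
  have hs : 1 - t ∈ Complex.slitPlane := by
    have := Complex.mem_slitPlane_of_norm_lt_one (z := -t) (by simpa using ht)
    rwa [← sub_eq_add_neg] at this
  have hl : HasDerivAt (fun t : ℂ => -Complex.log (1 - t)) ((1 - t)⁻¹) t := by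
    refine (((hasDerivAt_id' t).const_sub 1).clog hs).neg.congr_deriv ?_
    rw [neg_div, neg_neg, one_div]
  exact (hasDerivAt_exp_smul_const' P (-Complex.log (1 - t))).scomp t hl

/-- Each differentiation brings down `P` from the exponential and `n` from the scalar power, hence
the next factor `P + n`. At `t = 0` the derivatives are therefore the coefficients `(P)_n`. -/
theorem iteratedDeriv_exp_log (P : 𝔸) (n : ℕ) :
    Set.EqOn (iteratedDeriv n fun t : ℂ => NormedSpace.exp ((-Complex.log (1 - t)) • P))
      (fun t => ((1 - t)⁻¹ ^ n) • (rising P n * NormedSpace.exp ((-Complex.log (1 - t)) • P)))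
      (Metric.ball 0 1) := by
  induction n with
  | zero => intro t _; simp
  | succ n ih =>
    intro t ht
    have ht' : ‖t‖ < 1 := by simpa using ht
    have h1 : (1 - t) ≠ 0 := by
      intro h
      rw [sub_eq_zero] at h
      simp [← h] at ht'
    rw [iteratedDeriv_succ, (ih.eventuallyEq_of_mem (Metric.isOpen_ball.mem_nhds ht)).deriv_eq]
    have hp : HasDerivAt (fun t : ℂ => (1 - t)⁻¹ ^ n) (n * (1 - t)⁻¹ ^ (n + 1)) t := by
      refine ((((hasDerivAt_id' t).const_sub 1).fun_inv h1).fun_pow n).congr_deriv ?_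
      rcases n with _ | n
      · simp
      · simp only [Nat.add_sub_cancel, neg_neg, inv_pow]
        field_simp
        ring
    have h := hp.smul ((hasDerivAt_exp_log P ht').const_mul (rising P n))
    refine h.deriv.trans ?_
    simp only [rising_succ, mul_add, add_mul, mul_smul_comm, smul_mul_assoc, mul_one, smul_add,
      smul_smul, mul_assoc, pow_succ]
    congr 2
    ring

/-- The right side is holomorphic on the unit disc, so it is the sum of its Taylor series at `0`
there. -/
theorem binomSeries_eq_exp (P : 𝔸) {t : ℂ} (ht : ‖t‖ < 1) :
    binomSeries t P = NormedSpace.exp ((-Complex.log (1 - t)) • P) := by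
  have hd : DifferentiableOn ℂ (fun t : ℂ => NormedSpace.exp ((-Complex.log (1 - t)) • P))
      (Metric.ball 0 1) := fun z hz =>
    (hasDerivAt_exp_log P (by simpa using hz)).differentiableAt.differentiableWithinAt
  have h := Complex.hasSum_taylorSeries_on_ball hd (z := t) (by simpa using ht)
  rw [← h.tsum_eq]
  refine tsum_congr fun n => ?_
  rw [iteratedDeriv_exp_log P n (by simp), smul_smul]
  simp [div_eq_inv_mul]

end Banach

/-! ### Growth bounds and interchange of summations -/

section Core

variable {𝔸 : Type*} [NormedRing 𝔸] [NormedAlgebra ℂ 𝔸]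

/-- One term of a nonnegative series is at most its sum. The bound has the same shape in `k` as a
rescaling of the variables, and `τ` can be taken as small as desired. -/
theorem norm_rising_add_int_le (P : 𝔸) {τ : ℝ} (h0 : 0 < τ) (h1 : τ < 1) (N : ℕ) :
    ∃ K : ℝ, 0 ≤ K ∧ ∀ k : ℤ, ‖rising (P + (k : ℂ) • (1 : 𝔸)) N‖ ≤
      K * ((1 - τ) ^ (-k) + (1 + τ) ^ (-k)) := by
  have hS : 0 ≤ ∑' n, absTerm P τ n := tsum_nonneg (absTerm_nonneg P h0.le)
  refine ⟨(N ! : ℝ) / τ ^ N * ∑' n, absTerm P τ n, by positivity, fun k => ?_⟩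
  have h2 := (summable_absTerm (P + (k : ℂ) • (1 : 𝔸)) h0.le h1).le_tsum N
    fun n _ => absTerm_nonneg _ h0.le n
  have h3 := h2.trans (tsum_absTerm_add_int_le P h0.le h1 k)
  have h4 : ‖rising (P + (k : ℂ) • (1 : 𝔸)) N‖ =
      (N ! : ℝ) / τ ^ N * absTerm (P + (k : ℂ) • (1 : 𝔸)) τ N := by
    unfold absTerm
    field_simp
  calc _ = _ := h4
    _ ≤ (N ! : ℝ) / τ ^ N *
        (((1 - τ) ^ (-k) + (1 + τ) ^ (-k)) * ∑' n, absTerm P τ n) := by gcongr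
    _ = _ := by ring

/-- All terms are nonnegative, so it suffices to sum over the binomial index first and use the
uniform bound for integer shifts. -/
theorem summable_mul_absTerm {ι : Type*} (P : 𝔸) {τ : ℝ} (h0 : 0 ≤ τ) (h1 : τ < 1) (k : ι → ℤ)
    (w : ι → ℝ) (hw : ∀ p, 0 ≤ w p) (hs : Summable fun p => (1 - τ) ^ (-k p) * w p)
    (hs' : Summable fun p => (1 + τ) ^ (-k p) * w p) :
    Summable fun z : ι × ℕ => w z.1 * absTerm (P + (k z.1 : ℂ) • (1 : 𝔸)) τ z.2 := by
  rw [summable_prod_of_nonneg (fun z => mul_nonneg (hw _) (absTerm_nonneg _ h0 _))]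
  refine ⟨fun p => (summable_absTerm (P + (k p : ℂ) • (1 : 𝔸)) h0 h1).mul_left (w p), ?_⟩
  refine Summable.of_nonneg_of_le
    (fun p => tsum_nonneg fun n => mul_nonneg (hw _) (absTerm_nonneg _ h0 n))
    (fun p => ?_) ((hs.add hs').mul_right (∑' n, absTerm P τ n))
  simp only [tsum_mul_left]
  refine (mul_le_mul_of_nonneg_left (tsum_absTerm_add_int_le P h0 h1 (k p)) (hw p)).trans_eq ?_
  ring

theorem rescaled_monomial {K : Type*} [Field K] (x y q : K) (hq : q ≠ 0) (a b : ℤ) (m n : ℕ) :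
    (x * q ^ a) ^ m * (y * q ^ b) ^ n = q ^ (a * m + b * n) * (x ^ m * y ^ n) := by
  rw [zpow_add₀ hq, zpow_mul, zpow_mul, zpow_natCast, zpow_natCast]
  ring

variable [CompleteSpace 𝔸]

/-- Interchange of summations behind the summation formulae: `μ` stands for multiplication from
the left or from the right. -/
theorem hasSum_shift (μ : 𝔸 →L[ℂ] 𝔸 →L[ℂ] 𝔸) (hμ : ∀ u v, ‖μ u v‖ ≤ ‖u‖ * ‖v‖)
    (P : 𝔸) (a b : ℤ) (c : ℕ → ℕ → 𝔸) (d : ℕ → ℕ → ℕ → 𝔸) {x y t : ℂ} (ht : ‖t‖ < 1)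
    (hcd : ∀ N m n : ℕ, μ (rising P N) (d N m n) =
      μ (rising (P + ((-(a * m + b * n) : ℤ) : ℂ) • (1 : 𝔸)) N) (c m n))
    (h1 : Summable fun p : ℕ × ℕ => (‖x‖ * (1 - ‖t‖) ^ a) ^ p.1 * (‖y‖ * (1 - ‖t‖) ^ b) ^ p.2 /
      ((p.1 ! : ℝ) * (p.2 ! : ℝ)) * ‖c p.1 p.2‖)
    (h2 : Summable fun p : ℕ × ℕ => (‖x‖ * (1 + ‖t‖) ^ a) ^ p.1 * (‖y‖ * (1 + ‖t‖) ^ b) ^ p.2 /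
      ((p.1 ! : ℝ) * (p.2 ! : ℝ)) * ‖c p.1 p.2‖)
    (h3 : Summable fun p : ℕ × ℕ => ((x * (1 - t) ^ a) ^ p.1 * (y * (1 - t) ^ b) ^ p.2 /
      ((p.1 ! : ℂ) * (p.2 ! : ℂ))) • c p.1 p.2)
    (hd : ∀ N, Summable fun p : ℕ × ℕ =>
      (x ^ p.1 * y ^ p.2 / ((p.1 ! : ℂ) * (p.2 ! : ℂ))) • d N p.1 p.2) :
    HasSum (fun N : ℕ => (t ^ N / (N ! : ℂ)) • μ (rising P N)
        (∑' p : ℕ × ℕ, (x ^ p.1 * y ^ p.2 / ((p.1 ! : ℂ) * (p.2 ! : ℂ))) • d N p.1 p.2))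
      (μ (binomSeries t P) (∑' p : ℕ × ℕ, ((x * (1 - t) ^ a) ^ p.1 * (y * (1 - t) ^ b) ^ p.2 /
        ((p.1 ! : ℂ) * (p.2 ! : ℂ))) • c p.1 p.2)) := by
  have hq : 1 - t ≠ 0 := by
    intro h
    rw [sub_eq_zero] at h
    simp [← h] at ht
  have hτ : 0 < 1 - ‖t‖ := by linarith
  have hτ' : 0 < 1 + ‖t‖ := by positivity
  set k : ℕ × ℕ → ℤ := fun p => -(a * p.1 + b * p.2) with hk
  set w : ℕ × ℕ → ℂ := fun p => x ^ p.1 * y ^ p.2 / ((p.1 ! : ℂ) * (p.2 ! : ℂ)) with hw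
  set Q : ℕ × ℕ → 𝔸 := fun p => P + (k p : ℂ) • (1 : 𝔸) with hQ
  let u : (ℕ × ℕ) × ℕ → 𝔸 := fun z =>
    (w z.1 * (t ^ z.2 / (z.2 ! : ℂ))) • μ (rising (Q z.1) z.2) (c z.1.1 z.1.2)
  -- The two powers of `1 ∓ ‖t‖` in the bound are absorbed into the monomials, giving `h1` and `h2`.
  have hbound : Summable fun z : (ℕ × ℕ) × ℕ =>
      (‖w z.1‖ * ‖c z.1.1 z.1.2‖) * absTerm (Q z.1) ‖t‖ z.2 := by
    refine summable_mul_absTerm P (norm_nonneg t) ht k (fun p => ‖w p‖ * ‖c p.1 p.2‖)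
      (fun p => by positivity) (h1.congr fun p => ?_) (h2.congr fun p => ?_)
    · rw [rescaled_monomial _ _ _ hτ.ne', hk, hw]
      simp only [neg_neg, norm_div, norm_mul, norm_pow, Complex.norm_natCast]
      ring
    · rw [rescaled_monomial _ _ _ hτ'.ne', hk, hw]
      simp only [neg_neg, norm_div, norm_mul, norm_pow, Complex.norm_natCast]
      ring
  have hu : Summable u := by
    refine Summable.of_norm_bounded hbound fun z => ?_
    simp only [u, absTerm, norm_smul, norm_mul, norm_div, norm_pow, Complex.norm_natCast]
    calc _ ≤ ‖w z.1‖ * (‖t‖ ^ z.2 / (z.2 ! : ℝ)) *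
          (‖rising (Q z.1) z.2‖ * ‖c z.1.1 z.1.2‖) := by
          gcongr
          exact hμ _ _
      _ = _ := by ring
  -- Summing over `N` first yields the binomial series of `P + k`, whose scalar factor rescales the
  -- monomial.
  have fiber1 (p : ℕ × ℕ) : HasSum (fun N => u (p, N)) (μ (binomSeries t P)
      (((x * (1 - t) ^ a) ^ p.1 * (y * (1 - t) ^ b) ^ p.2 /
        ((p.1 ! : ℂ) * (p.2 ! : ℂ))) • c p.1 p.2)) := by
    have h := ((summable_rising (Q p) ht).hasSum.mapL (μ.flip (c p.1 p.2))).const_smul (w p)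
    have e : ∑' n : ℕ, (t ^ n / (n ! : ℂ)) • rising (Q p) n = (1 - t) ^ (-k p) • binomSeries t P :=
      binomSeries_add_int P ht (k p)
    rw [e] at h
    simp only [map_smul, ContinuousLinearMap.flip_apply, smul_smul] at h
    rw [map_smul, rescaled_monomial _ _ _ hq]
    have e2 : (1 - t) ^ (a * (p.1 : ℤ) + b * p.2) * (x ^ p.1 * y ^ p.2) /
        ((p.1 ! : ℂ) * (p.2 ! : ℂ)) = w p * (1 - t) ^ (-k p) := by
      simp only [hk, hw, neg_neg]
      ring
    rw [e2]
    exact h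
  have sum1 : HasSum u (μ (binomSeries t P) (∑' p : ℕ × ℕ,
      ((x * (1 - t) ^ a) ^ p.1 * (y * (1 - t) ^ b) ^ p.2 /
        ((p.1 ! : ℂ) * (p.2 ! : ℂ))) • c p.1 p.2)) := by
    have := hu.hasSum.prod_fiberwise fiber1
    rw [(h3.hasSum.mapL (μ (binomSeries t P))).unique this]
    exact hu.hasSum
  -- In the other order, for fixed `N`, `hcd` identifies the inner sum with the series for the
  -- shifted coefficients.
  have hswap := (Equiv.prodComm ℕ (ℕ × ℕ)).hasSum_iff.2 sum1
  refine hswap.prod_fiberwise fun N => ?_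
  have h := ((hd N).hasSum.mapL (μ (rising P N))).const_smul (t ^ N / (N ! : ℂ))
  convert h using 2 with p
  simp only [Function.comp, Equiv.prodComm_apply, Prod.swap, u, map_smul, smul_smul, hcd, hQ, hk,
    hw]
  rw [mul_comm]

end Core

/-! ### The matrix Pochhammer symbol at integer index -/

section Pochhammer

variable {r : ℕ}

theorem commute_smul_one_add {P X : Mat r} (h : Commute P X) (z : ℂ) :
    Commute (P + z • (1 : Mat r)) X :=
  h.add_left ((Commute.one_left X).smul_left z)

/-- Invertibility is not needed: the inverse of a singular matrix is `0` by convention. -/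
theorem commute_inv {A X : Mat r} (h : Commute A X) : Commute A⁻¹ X := by
  by_cases hA : IsUnit A
  · obtain ⟨U, rfl⟩ := hA
    rw [← Matrix.coe_units_inv]
    exact h.units_inv_left
  · rw [Matrix.nonsing_inv_eq_ringInverse, Ring.inverse_non_unit _ hA]
    exact Commute.zero_left X

theorem commute_poch {P X : Mat r} (h : Commute P X) (k : ℤ) : Commute (poch P k) X := by
  match k with
  | Int.ofNat n => exact commute_rising h n
  | Int.negSucc n =>
    exact (commute_inv (commute_rising ((Commute.one_left X).sub_left h) (n + 1))).smul_left _

theorem poch_natCast (P : Mat r) (n : ℕ) : poch P (n : ℤ) = rising P n := rfl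

theorem poch_neg_mul (P : Mat r) (n : ℕ) (h : IsUnit (rising (P - (n : ℂ) • (1 : Mat r)) n)) :
    poch P (-(n : ℤ)) * rising (P - (n : ℂ) • (1 : Mat r)) n = 1 := by
  rcases n with _ | n
  · simp [poch_zero]
  · rw [← rising_one_sub] at h ⊢
    have h' : IsUnit (rising (1 - P) (n + 1)).det := by
      rw [Matrix.isUnit_iff_isUnit_det] at h
      exact isUnit_of_mul_isUnit_right (Matrix.det_smul (rising (1 - P) (n + 1)) _ ▸ h)
    change (((-1 : ℂ) ^ (n + 1)) • (rising (1 - P) (n + 1))⁻¹) * _ = 1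
    rw [smul_mul_smul_comm, Matrix.nonsing_inv_mul _ h', ← mul_pow]
    simp

theorem isUnit_rising_of_intRegular {P : Mat r} (h : IntRegular P) (j : ℤ) (n : ℕ) :
    IsUnit (rising (P + (j : ℂ) • (1 : Mat r)) n) := by
  refine isUnit_rising n fun i _ => ?_
  have := h (j + i)
  rw [Int.cast_add, Int.cast_natCast, add_smul, ← add_assoc] at this
  exact this

/-- `(P)_N (P + N)_k = (P + k)_N (P)_k`. -/
theorem rising_mul_poch_shift (P : Mat r) (N : ℕ) (k : ℤ) (h : 0 ≤ k ∨ IntRegular P) :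
    rising P N * poch (P + (N : ℂ) • (1 : Mat r)) k =
      rising (P + (k : ℂ) • (1 : Mat r)) N * poch P k := by
  have nat (n : ℕ) : rising P N * poch (P + (N : ℂ) • (1 : Mat r)) n =
      rising (P + ((n : ℤ) : ℂ) • (1 : Mat r)) N * poch P n := by
    rw [poch_natCast, ← rising_add, poch_natCast, add_comm, rising_add, Int.cast_natCast]
    exact (commute_rising (commute_rising (commute_smul_one_add (Commute.refl P) _) N).symm n).eq
  rcases Int.eq_nat_or_neg k with ⟨n, rfl | rfl⟩
  · exact nat n
  · rcases h with h | h
    · obtain rfl : n = 0 := by omega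
      exact nat 0
    · set P' := P - (n : ℂ) • (1 : Mat r) with hP'
      have e1 : P + ((-(n : ℤ) : ℤ) : ℂ) • (1 : Mat r) = P' := by
        rw [hP']; push_cast; module
      have e2 : P + (N : ℂ) • (1 : Mat r) - (n : ℂ) • (1 : Mat r) = P' + (N : ℂ) • (1 : Mat r) := by
        rw [hP']; module
      have e3 : P' + (n : ℂ) • (1 : Mat r) = P := by
        rw [hP']; module
      have hU : IsUnit (rising P' n) := e1 ▸ isUnit_rising_of_intRegular h (-(n : ℤ)) n
      have hV : IsUnit (rising (P' + (N : ℂ) • (1 : Mat r)) n) := by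
        have := isUnit_rising_of_intRegular h (N - n) n
        convert this using 2
        rw [hP']; push_cast; module
      have k1 := poch_neg_mul P n hU
      have k2 := poch_neg_mul (P + (N : ℂ) • (1 : Mat r)) n (e2 ▸ hV)
      rw [e2] at k2
      rw [← hP'] at k1
      rw [e1]
      -- Both sides are `(P')_{n + N}`, split after `n` factors or after `N` factors.
      have k3 : rising P' n * rising P N = rising P' N * rising (P' + (N : ℂ) • (1 : Mat r)) n := by
        rw [← rising_add, add_comm N n, rising_add, e3]
      have k4 : Commute (poch P (-(n : ℤ))) (rising P' N) :=
        commute_poch (commute_rising ((Commute.refl P).sub_left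
          ((Commute.one_left P).smul_left _)) N).symm _
      have k5 : rising P N = poch P (-(n : ℤ)) * rising P' N *
          rising (P' + (N : ℂ) • (1 : Mat r)) n := by
        rw [mul_assoc, ← k3, ← mul_assoc, k1, one_mul]
      rw [k5, mul_assoc, (mul_eq_one_comm.1 k2), mul_one, k4.eq]

end Pochhammer

/-! ### Domains of convergence and the general shift formula -/

section Domain

attribute [local instance] Matrix.linftyOpNormedRing Matrix.linftyOpNormedAlgebra

variable {r : ℕ}

theorem norm_entry_le (A : Mat r) (i j : Fin r) : ‖A i j‖ ≤ ‖A‖ := by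
  rw [← coe_nnnorm, ← coe_nnnorm, NNReal.coe_le_coe, Matrix.linfty_opNNNorm_def]
  exact (Finset.single_le_sum (f := fun j => ‖A i j‖₊) (fun _ _ => zero_le) (Finset.mem_univ j)).trans
    (Finset.le_sup (f := fun i => ∑ j, ‖A i j‖₊) (Finset.mem_univ i))

theorem norm_le_sum_entries (A : Mat r) : ‖A‖ ≤ ∑ i, ∑ j, ‖A i j‖ := by
  have : ‖A‖₊ ≤ ∑ i, ∑ j, ‖A i j‖₊ := by
    rw [Matrix.linfty_opNNNorm_def]
    exact Finset.sup_le fun i _ =>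
      Finset.single_le_sum (f := fun i => ∑ j, ‖A i j‖₊) (fun _ _ => zero_le) (Finset.mem_univ i)
  refine (NNReal.coe_le_coe.2 this).trans_eq ?_
  push_cast
  rfl

theorem mem_domain_iff (c : DoubleSeries r) (x y : ℂ) :
    (x, y) ∈ c.domain ↔ ∃ R S : ℝ, ‖x‖ < R ∧ ‖y‖ < S ∧ Summable fun p : ℕ × ℕ =>
      R ^ p.1 * S ^ p.2 / ((p.1 ! : ℝ) * (p.2 ! : ℝ)) * ‖c p.1 p.2‖ := by
  refine exists_congr fun R => exists_congr fun S => and_congr_right fun hR =>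
    and_congr_right fun hS => ?_
  have hR0 : 0 ≤ R := (norm_nonneg _).trans hR.le
  have hS0 : 0 ≤ S := (norm_nonneg _).trans hS.le
  constructor
  · intro h
    refine Summable.of_nonneg_of_le (fun p => by positivity) (fun p => ?_)
      (summable_sum (s := Finset.univ) fun i _ => summable_sum (s := Finset.univ) fun j _ => h i j)
    simp only [← Finset.mul_sum]
    gcongr
    exact norm_le_sum_entries _
  · intro h i j
    refine Summable.of_nonneg_of_le (fun p => by positivity) (fun p => ?_) h
    gcongr
    exact norm_entry_le _ i j

theorem summable_norm_of_mem_domain {c : DoubleSeries r} {x y : ℂ} (h : (x, y) ∈ c.domain) :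
    Summable fun p : ℕ × ℕ =>
      ‖x‖ ^ p.1 * ‖y‖ ^ p.2 / ((p.1 ! : ℝ) * (p.2 ! : ℝ)) * ‖c p.1 p.2‖ := by
  obtain ⟨R, S, hR, hS, hs⟩ := (mem_domain_iff c x y).1 h
  refine Summable.of_nonneg_of_le (fun p => by positivity) (fun p => ?_) hs
  have hR0 : 0 ≤ R := (norm_nonneg _).trans hR.le
  gcongr

theorem summable_of_mem_domain {c : DoubleSeries r} {x y : ℂ} (h : (x, y) ∈ c.domain) :
    Summable fun p : ℕ × ℕ =>
      (x ^ p.1 * y ^ p.2 / ((p.1 ! : ℂ) * (p.2 ! : ℂ))) • c p.1 p.2 := by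
  have : CompleteSpace (Mat r) := FiniteDimensional.complete ℂ (Mat r)
  refine Summable.of_norm ((summable_norm_of_mem_domain h).congr fun p => ?_)
  simp [norm_smul]

/-- The growth factors amount to rescaling the radii by powers of `1 ∓ τ`. These tend to `1` as `τ →
0`, so slightly smaller radii, still above `‖x‖` and `‖y‖`, stay below the original ones. -/
theorem mem_domain_of_le {c d : DoubleSeries r} {x y : ℂ} (a b : ℤ) (h : (x, y) ∈ c.domain)
    (hd : ∀ τ : ℝ, 0 < τ → τ < 1 → ∃ K : ℝ, 0 ≤ K ∧ ∀ m n : ℕ, ‖d m n‖ ≤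
      K * ((1 - τ) ^ (a * m + b * n) + (1 + τ) ^ (a * m + b * n)) * ‖c m n‖) :
    (x, y) ∈ d.domain := by
  obtain ⟨R, S, hR, hS, hs⟩ := (mem_domain_iff c x y).1 h
  obtain ⟨R', hxR', hR'⟩ := exists_between hR
  obtain ⟨S', hyS', hS'⟩ := exists_between hS
  have hR0 : 0 ≤ R' := (norm_nonneg _).trans hxR'.le
  have hS0 : 0 ≤ S' := (norm_nonneg _).trans hyS'.le
  have ev (ρ σ ε : ℝ) (e : ℤ) (hρ : ρ < σ) :
      ∀ᶠ τ : ℝ in nhdsWithin 0 (Set.Ioi 0), ρ * (1 + ε * τ) ^ e < σ := by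
    have hc : ContinuousAt (fun τ : ℝ => ρ * (1 + ε * τ) ^ e) 0 :=
      continuousAt_const.mul (ContinuousAt.zpow₀ (by fun_prop) _ (Or.inl (by simp)))
    exact (hc.eventually_lt_const (by simpa using hρ)).filter_mono nhdsWithin_le_nhds
  have ev1 : ∀ᶠ τ : ℝ in nhdsWithin 0 (Set.Ioi 0), τ ∈ Set.Ioo (0 : ℝ) 1 :=
    Ioo_mem_nhdsGT one_pos
  obtain ⟨τ, ⟨h0, h1⟩, e1, e2, e3, e4⟩ := (ev1.and ((ev R' R (-1) a hR').and
    ((ev S' S (-1) b hS').and ((ev R' R 1 a hR').and (ev S' S 1 b hS'))))).exists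
  rw [neg_one_mul, ← sub_eq_add_neg] at e1 e2
  rw [one_mul] at e3 e4
  have hτ : 0 < 1 - τ := by linarith
  have hτ' : 0 < 1 + τ := by linarith
  obtain ⟨K, hK, hd⟩ := hd τ h0 h1
  refine (mem_domain_iff d x y).2 ⟨R', S', hxR', hyS', ?_⟩
  refine Summable.of_nonneg_of_le (fun p => by positivity) (fun p => ?_) (hs.mul_left (2 * K))
  calc R' ^ p.1 * S' ^ p.2 / ((p.1 ! : ℝ) * (p.2 ! : ℝ)) * ‖d p.1 p.2‖
      ≤ R' ^ p.1 * S' ^ p.2 / ((p.1 ! : ℝ) * (p.2 ! : ℝ)) *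
        (K * ((1 - τ) ^ (a * p.1 + b * p.2) + (1 + τ) ^ (a * p.1 + b * p.2)) * ‖c p.1 p.2‖) := by
        gcongr
        exact hd _ _
    _ = ((R' * (1 - τ) ^ a) ^ p.1 * (S' * (1 - τ) ^ b) ^ p.2 +
          (R' * (1 + τ) ^ a) ^ p.1 * (S' * (1 + τ) ^ b) ^ p.2) *
        (K / ((p.1 ! : ℝ) * (p.2 ! : ℝ)) * ‖c p.1 p.2‖) := by
        rw [rescaled_monomial _ _ _ hτ.ne', rescaled_monomial _ _ _ hτ'.ne']
        ring
    _ ≤ (R ^ p.1 * S ^ p.2 + R ^ p.1 * S ^ p.2) *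
        (K / ((p.1 ! : ℝ) * (p.2 ! : ℝ)) * ‖c p.1 p.2‖) := by
        have : 0 ≤ R := hR0.trans hR'.le
        gcongr
    _ = _ := by ring

/-- `μ` is left or right multiplication; `hmul` asks for commuting factors because right
multiplication reverses products. In `hF`, `Q` ranges over matrices commuting with everything that
commutes with `P`, such as `P + N`, so commutation with another parameter survives the shift while
`D` stays fixed. When `a, b ≤ 0` all indices are nonnegative and no inverses occur, whence the
alternative `hreg`. -/
theorem shift_formula (μ : Mat r →L[ℂ] Mat r →L[ℂ] Mat r) (hμ : ∀ u v, ‖μ u v‖ ≤ ‖u‖ * ‖v‖)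
    (hone : ∀ v, μ 1 v = v) (hmul : ∀ u v w, Commute u v → μ u (μ v w) = μ (u * v) w)
    (F : Mat r → DoubleSeries r) (P : Mat r) (a b : ℤ) (hreg : (a ≤ 0 ∧ b ≤ 0) ∨ IntRegular P)
    (hF : ∀ m n : ℕ, ∃ D : Mat r, ∀ Q : Mat r, (∀ X, Commute P X → Commute Q X) →
      F Q m n = μ (poch Q (-(a * m + b * n))) D)
    {x y t : ℂ} (h : Admissible F P a b x y t) :
    (∀ n : ℕ, (x, y) ∈ (F (P + (n : ℂ) • (1 : Mat r))).domain) ∧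
    HasSum
      (fun n : ℕ => (t ^ n / (n ! : ℂ)) •
        μ (poch P n) ((F (P + (n : ℂ) • (1 : Mat r))).eval x y))
      (μ (oneSubPowNeg t P) ((F P).eval (x * (1 - t) ^ a) (y * (1 - t) ^ b))) := by
  have : CompleteSpace (Mat r) := FiniteDimensional.complete ℂ (Mat r)
  obtain ⟨ht, hdom, hsing⟩ := h
  choose D hD using hF
  have key (N m n : ℕ) : μ (rising P N) (F (P + (N : ℂ) • (1 : Mat r)) m n) =
      μ (rising (P + ((-(a * m + b * n) : ℤ) : ℂ) • (1 : Mat r)) N) (F P m n) := by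
    have hk : 0 ≤ -(a * m + b * n) ∨ IntRegular P := by
      refine hreg.imp_left fun hab => ?_
      have h1 := mul_nonpos_of_nonpos_of_nonneg hab.1 (Int.natCast_nonneg m)
      have h2 := mul_nonpos_of_nonpos_of_nonneg hab.2 (Int.natCast_nonneg n)
      linarith
    rw [hD m n _ fun X hX => commute_smul_one_add hX _, hD m n P fun X hX => hX, hmul, hmul,
      rising_mul_poch_shift P N _ hk]
    · exact commute_rising
        (commute_smul_one_add (commute_poch (Commute.refl P) _).symm _) N
    · exact commute_rising
        (commute_poch (commute_smul_one_add (Commute.refl P) _) _).symm N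
  have hxy : (x, y) ∈ (F P).domain := by simpa using hdom 0 (by simp)
  have dom (N : ℕ) : (x, y) ∈ (F (P + (N : ℂ) • (1 : Mat r))).domain := by
    -- If `(P)_N` is invertible, `key` can be solved for the shifted coefficients; otherwise
    -- convergence is part of admissibility.
    by_cases hN : IsUnit (poch P N)
    · obtain ⟨U, hU⟩ := hN
      refine mem_domain_of_le a b hxy fun τ h0 h1 => ?_
      obtain ⟨K, hK, hb⟩ := norm_rising_add_int_le P h0 h1 N
      refine ⟨‖(↑U⁻¹ : Mat r)‖ * K, by positivity, fun m n => ?_⟩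
      have e : F (P + (N : ℂ) • (1 : Mat r)) m n = μ (↑U⁻¹ : Mat r)
          (μ (rising (P + ((-(a * m + b * n) : ℤ) : ℂ) • (1 : Mat r)) N) (F P m n)) := by
        rw [← key, ← poch_natCast, ← hU, hmul _ _ _ (Commute.refl (U : Mat r)).units_inv_left,
          Units.inv_mul, hone]
      rw [e]
      refine (hμ _ _).trans ?_
      have hb' := hb (-(a * m + b * n))
      rw [neg_neg] at hb'
      calc _ ≤ ‖(↑U⁻¹ : Mat r)‖ * (‖rising (P + ((-(a * m + b * n) : ℤ) : ℂ) • (1 : Mat r)) N‖ *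
            ‖F P m n‖) := by
            gcongr
            exact hμ _ _
        _ ≤ ‖(↑U⁻¹ : Mat r)‖ *
            ((K * ((1 - τ) ^ (a * m + b * n) + (1 + τ) ^ (a * m + b * n))) * ‖F P m n‖) := by
            gcongr
        _ = _ := by ring
    · exact hsing N hN
  refine ⟨dom, ?_⟩
  have hτ : 0 < 1 - ‖t‖ := by linarith
  have hτ' : 0 < 1 + ‖t‖ := by positivity
  have n1 : ‖1 - (‖t‖ : ℂ)‖ = 1 - ‖t‖ := by
    rw [← Complex.ofReal_one, ← Complex.ofReal_sub, Complex.norm_of_nonneg hτ.le]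
  have n2 : ‖1 - (-(‖t‖ : ℂ))‖ = 1 + ‖t‖ := by
    rw [sub_neg_eq_add, ← Complex.ofReal_one, ← Complex.ofReal_add,
      Complex.norm_of_nonneg hτ'.le]
  -- The points `s = ‖t‖` and `s = -‖t‖` of the disc realise the rescalings by `1 - ‖t‖` and `1 +
  -- ‖t‖`.
  have s1 := summable_norm_of_mem_domain (hdom (‖t‖ : ℂ) (by simp))
  have s2 := summable_norm_of_mem_domain (hdom (-(‖t‖ : ℂ)) (by simp))
  simp only [norm_mul, norm_zpow, n1] at s1
  simp only [norm_mul, norm_zpow, n2] at s2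
  have main := hasSum_shift μ hμ P a b (F P) (fun N => F (P + (N : ℂ) • (1 : Mat r))) ht key s1 s2
    (summable_of_mem_domain (hdom t le_rfl)) (fun N => summable_of_mem_domain (dom N))
  rw [binomSeries_eq_exp P ht] at main
  exact main

/-- The index `k` is kept separate from `-(am + bn)` so that it can be given as it is written in
each series. -/
theorem leftFormula_of_eq_mul (F : Mat r → DoubleSeries r) (P : Mat r) (a b : ℤ)
    (k : ℕ → ℕ → ℤ) (hk : ∀ m n : ℕ, k m n = -(a * m + b * n))
    (hreg : (a ≤ 0 ∧ b ≤ 0) ∨ IntRegular P)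
    (hF : ∀ m n : ℕ, ∃ D : Mat r, ∀ Q : Mat r, (∀ X, Commute P X → Commute Q X) →
      F Q m n = poch Q (k m n) * D) :
    LeftFormula F P a b := by
  intro x y t h
  refine shift_formula (ContinuousLinearMap.mul ℂ (Mat r)) (fun u v => norm_mul_le u v)
    (fun v => one_mul v) (fun u v w _ => (mul_assoc u v w).symm) F P a b hreg ?_ h
  simp only [hk] at hF
  exact hF

theorem rightFormula_of_eq_mul (F : Mat r → DoubleSeries r) (P : Mat r) (a b : ℤ)
    (k : ℕ → ℕ → ℤ) (hk : ∀ m n : ℕ, k m n = -(a * m + b * n))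
    (hreg : (a ≤ 0 ∧ b ≤ 0) ∨ IntRegular P)
    (hF : ∀ m n : ℕ, ∃ D : Mat r, ∀ Q : Mat r, (∀ X, Commute P X → Commute Q X) →
      F Q m n = D * poch Q (k m n)) :
    RightFormula F P a b := by
  intro x y t h
  refine shift_formula (ContinuousLinearMap.mul ℂ (Mat r)).flip
    (fun u v => (norm_mul_le v u).trans_eq (mul_comm _ _))
    (fun v => mul_one v) (fun u v w huv => ?_) F P a b hreg ?_ h
  · change w * v * u = w * (u * v)
    rw [mul_assoc, huv.eq]
  · simp only [hk] at hF
    exact hF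

theorem commute_poch_poch {A B : Mat r} (h : Commute A B) (j k : ℤ) :
    Commute (poch A j) (poch B k) :=
  commute_poch (commute_poch h.symm k).symm j

theorem commute_poch_poch_inv {A B : Mat r} (h : Commute A B) (j k : ℤ) :
    Commute (poch A j) (poch B k)⁻¹ :=
  (commute_inv (commute_poch_poch h j k).symm).symm

end Domain

end HornMatrix

/-! ### The formulae for the individual functions -/

theorem mainTheorem10 (r : ℕ) :
    -- G₂
    (∀ A A' B B' : Mat r, NegRegular B → NegRegular B' →
      LeftFormula (fun P => G2 P A' B B') A (-1) 0 ∧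
      (A * A' = A' * A → LeftFormula (fun P => G2 A P B B') A' 0 (-1)) ∧
      (IntRegular B → B * B' = B' * B → RightFormula (fun P => G2 A A' P B') B 1 (-1)) ∧
      (IntRegular B' → RightFormula (fun P => G2 A A' B P) B' (-1) 1)) ∧
    -- G₃
    (∀ A A' : Mat r, NegRegular A → NegRegular A' →
      (IntRegular A → LeftFormula (fun P => G3 P A') A 1 (-2)) ∧
      (IntRegular A' → RightFormula (fun P => G3 A P) A' (-2) 1)) ∧
    -- H₁
    (∀ A B C C' : Mat r, NegRegular A → NonnegRegular C' →
      (IntRegular A → LeftFormula (fun P => H1 P B C C') A (-1) 1) ∧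
      (A * B = B * A → LeftFormula (fun P => H1 A P C C') B (-1) (-1)) ∧
      (C * C' = C' * C → RightFormula (fun P => H1 A B P C') C 0 (-1))) ∧
    -- H₂
    (∀ A B C C' C'' : Mat r, NegRegular A → NonnegRegular C'' →
      (IntRegular A → LeftFormula (fun P => H2 P B C C' C'') A (-1) 1) ∧
      (A * B = B * A → LeftFormula (fun P => H2 A P C C' C'') B (-1) 0) ∧
      (C * C' = C' * C → C * C'' = C'' * C →
        RightFormula (fun P => H2 A B P C' C'') C 0 (-1)) ∧
      (C' * C'' = C'' * C' → RightFormula (fun P => H2 A B C P C'') C' 0 (-1))) ∧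
    -- H₃
    (∀ A B C : Mat r, NonnegRegular C →
      LeftFormula (fun P => H3 P B C) A (-2) (-1) ∧
      (A * B = B * A → LeftFormula (fun P => H3 A P C) B 0 (-1))) ∧
    -- H₄
    (∀ A B C C' : Mat r, NonnegRegular C → NonnegRegular C' →
      LeftFormula (fun P => H4 P B C C') A (-2) (-1) ∧
      (A * B = B * A → LeftFormula (fun P => H4 A P C C') B 0 (-1))) ∧
    -- H₅
    (∀ A B C : Mat r, NegRegular B → NonnegRegular C →
      LeftFormula (fun P => H5 P B C) A (-2) (-1) ∧
      (IntRegular B → A * B = B * A → LeftFormula (fun P => H5 A P C) B 1 (-1))) ∧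
    -- H₆
    (∀ A B C : Mat r, NegRegular A → NegRegular B →
      (IntRegular A → LeftFormula (fun P => H6 P B C) A (-2) 1) ∧
      (IntRegular B → A * B = B * A → LeftFormula (fun P => H6 A P C) B 1 (-1))) ∧
    -- H₇
    (∀ A B C C' : Mat r, NegRegular A → NonnegRegular C' →
      (IntRegular A → LeftFormula (fun P => H7 P B C C') A (-2) 1) ∧
      (A * B = B * A → LeftFormula (fun P => H7 A P C C') B 0 (-1)) ∧
      (C * C' = C' * C → RightFormula (fun P => H7 A B P C') C 0 (-1))) ∧
    -- Γ₁
    (∀ A B B' : Mat r, NegRegular B → NegRegular B' →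
      LeftFormula (fun P => Gamma1 P B B') A (-1) 0 ∧
      (IntRegular B → B * B' = B' * B → RightFormula (fun P => Gamma1 A P B') B 1 (-1)) ∧
      (IntRegular B' → RightFormula (fun P => Gamma1 A B P) B' (-1) 1)) ∧
    -- Γ₂
    (∀ B B' : Mat r, NegRegular B → NegRegular B' →
      (IntRegular B → LeftFormula (fun P => Gamma2 P B') B 1 (-1)) ∧
      (IntRegular B' → RightFormula (fun P => Gamma2 B P) B' (-1) 1)) ∧
    -- ℋ₁
    (∀ A B C : Mat r, NegRegular A → NonnegRegular C →
      (IntRegular A → LeftFormula (fun P => calH1 P B C) A (-1) 1) ∧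
      (A * B = B * A → LeftFormula (fun P => calH1 A P C) B (-1) (-1))) ∧
    -- ℋ₂
    (∀ A B B' C : Mat r, NegRegular A → NonnegRegular C →
      (IntRegular A → LeftFormula (fun P => calH2 P B B' C) A (-1) 1) ∧
      (A * B = B * A → LeftFormula (fun P => calH2 A P B' C) B (-1) 0) ∧
      (B' * C = C * B' → RightFormula (fun P => calH2 A B P C) B' 0 (-1))) ∧
    -- ℋ₃
    (∀ A B C : Mat r, NegRegular A → NonnegRegular C →
      (IntRegular A → LeftFormula (fun P => calH3 P B C) A (-1) 1) ∧
      (A * B = B * A → LeftFormula (fun P => calH3 A P C) B (-1) 0)) ∧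
    -- ℋ₄
    (∀ A B' C : Mat r, NegRegular A → NonnegRegular C →
      (IntRegular A → LeftFormula (fun P => calH4 P B' C) A (-1) 1) ∧
      (A * B' = B' * A → LeftFormula (fun P => calH4 A P C) B' 0 (-1))) ∧
    -- ℋ₅
    (∀ A C : Mat r, IntRegular A → NonnegRegular C →
      LeftFormula (fun P => calH5 P C) A (-1) 1) ∧
    -- ℋ₆
    (∀ A C : Mat r, NonnegRegular C →
      LeftFormula (fun P => calH6 P C) A (-2) (-1)) ∧
    -- ℋ₇
    (∀ A C C' : Mat r, NonnegRegular C → NonnegRegular C' →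
      LeftFormula (fun P => calH7 P C C') A (-2) (-1)) ∧
    -- ℋ₈
    (∀ A B : Mat r, NegRegular A → NegRegular B →
      (IntRegular A → LeftFormula (fun P => calH8 P B) A (-2) 1) ∧
      (IntRegular B → RightFormula (fun P => calH8 A P) B 1 (-1))) ∧
    -- ℋ₉
    (∀ A B C : Mat r, NegRegular A → NonnegRegular C →
      (IntRegular A → LeftFormula (fun P => calH9 P B C) A (-2) 1) ∧
      (A * B = B * A → LeftFormula (fun P => calH9 A P C) B 0 (-1))) ∧
    -- ℋ₁₀
    (∀ A C : Mat r, IntRegular A → NonnegRegular C →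
      LeftFormula (fun P => calH10 P C) A (-2) 1) ∧
    -- ℋ₁₁
    (∀ A B C C' : Mat r, NegRegular A → NonnegRegular C' →
      (IntRegular A → LeftFormula (fun P => calH11 P B C C') A (-1) 1) ∧
      (A * B = B * A → LeftFormula (fun P => calH11 A P C C') B 0 (-1)) ∧
      (C * C' = C' * C → RightFormula (fun P => calH11 A B P C') C 0 (-1))) := by
  refine ⟨?_, ?_, ?_, ?_, ?_, ?_, ?_, ?_, ?_, ?_, ?_, ?_, ?_, ?_, ?_, ?_, ?_, ?_, ?_, ?_, ?_, ?_⟩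
  · intro A A' B B' _ _
    -- Every item reduces to its index, the sign or regularity alternative, and bringing the shifted
    -- factor to the outer end; `D`, the product of the other factors, is found by unification.
    refine ⟨leftFormula_of_eq_mul _ _ _ _ (fun m n => (m : ℤ))
      (fun m n => by ring) (.inl (by norm_num)) fun m n => ⟨_, fun Q _ => by simp only [G2, mul_assoc]; rfl⟩,
      fun h => leftFormula_of_eq_mul _ _ _ _ (fun m n => (n : ℤ))
      (fun m n => by ring) (.inl (by norm_num)) fun m n => ⟨_, fun Q hQ => by
        simp only [G2, mul_assoc]
        exact (commute_poch_poch (hQ _ h.symm) _ _).symm.left_comm _⟩,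
      fun hZ h => rightFormula_of_eq_mul _ _ _ _ (fun m n => (n : ℤ) - m)
      (fun m n => by ring) (.inr hZ) fun m n => ⟨_, fun Q hQ => (commute_poch_poch (hQ _ h) _ _).right_comm _⟩,
      fun hZ => rightFormula_of_eq_mul _ _ _ _ (fun m n => (m : ℤ) - n)
      (fun m n => by ring) (.inr hZ) fun m n => ⟨_, fun Q _ => rfl⟩⟩
  · intro A A' _ _
    refine ⟨fun hZ => leftFormula_of_eq_mul _ _ _ _ (fun m n => 2 * (n : ℤ) - m)
      (fun m n => by ring) (.inr hZ) fun m n => ⟨_, fun Q _ => rfl⟩,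
      fun hZ => rightFormula_of_eq_mul _ _ _ _ (fun m n => 2 * (m : ℤ) - n)
      (fun m n => by ring) (.inr hZ) fun m n => ⟨_, fun Q _ => rfl⟩⟩
  · intro A B C C' _ _
    refine ⟨fun hZ => leftFormula_of_eq_mul _ _ _ _ (fun m n => (m : ℤ) - n)
      (fun m n => by ring) (.inr hZ) fun m n => ⟨_, fun Q _ => by simp only [H1, mul_assoc]; rfl⟩,
      fun h => leftFormula_of_eq_mul _ _ _ _ (fun m n => (m : ℤ) + n)
      (fun m n => by ring) (.inl (by norm_num)) fun m n => ⟨_, fun Q hQ => by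
        simp only [H1, mul_assoc]
        exact (commute_poch_poch (hQ _ h.symm) _ _).symm.left_comm _⟩,
      fun h => rightFormula_of_eq_mul _ _ _ _ (fun m n => (n : ℤ))
      (fun m n => by ring) (.inl (by norm_num)) fun m n => ⟨_, fun Q hQ => (commute_poch_poch_inv (hQ _ h) _ _).right_comm _⟩⟩
  · intro A B C C' C'' _ _
    refine ⟨fun hZ => leftFormula_of_eq_mul _ _ _ _ (fun m n => (m : ℤ) - n)
      (fun m n => by ring) (.inr hZ) fun m n => ⟨_, fun Q _ => by simp only [H2, mul_assoc]; rfl⟩,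
      fun h => leftFormula_of_eq_mul _ _ _ _ (fun m n => (m : ℤ))
      (fun m n => by ring) (.inl (by norm_num)) fun m n => ⟨_, fun Q hQ => by
        simp only [H2, mul_assoc]
        exact (commute_poch_poch (hQ _ h.symm) _ _).symm.left_comm _⟩,
      fun h h' => rightFormula_of_eq_mul _ _ _ _ (fun m n => (n : ℤ))
      (fun m n => by ring) (.inl (by norm_num)) fun m n => ⟨_, fun Q hQ => by
        simp only [H2]
        -- The shifted factor has to pass both `(C')_n` and `(C'')_m⁻¹`, hence the two commutation
        -- hypotheses.
        rw [(commute_poch_poch (hQ _ h) _ _).right_comm]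
        exact (commute_poch_poch_inv (hQ _ h') _ _).right_comm _⟩,
      fun h => rightFormula_of_eq_mul _ _ _ _ (fun m n => (n : ℤ))
      (fun m n => by ring) (.inl (by norm_num)) fun m n => ⟨_, fun Q hQ => (commute_poch_poch_inv (hQ _ h) _ _).right_comm _⟩⟩
  · intro A B C _
    refine ⟨leftFormula_of_eq_mul _ _ _ _ (fun m n => 2 * (m : ℤ) + n)
      (fun m n => by ring) (.inl (by norm_num)) fun m n => ⟨_, fun Q _ => by simp only [H3, mul_assoc]; rfl⟩,
      fun h => leftFormula_of_eq_mul _ _ _ _ (fun m n => (n : ℤ))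
      (fun m n => by ring) (.inl (by norm_num)) fun m n => ⟨_, fun Q hQ => by
        simp only [H3, mul_assoc]
        exact (commute_poch_poch (hQ _ h.symm) _ _).symm.left_comm _⟩⟩
  · intro A B C C' _ _
    refine ⟨leftFormula_of_eq_mul _ _ _ _ (fun m n => 2 * (m : ℤ) + n)
      (fun m n => by ring) (.inl (by norm_num)) fun m n => ⟨_, fun Q _ => by simp only [H4, mul_assoc]; rfl⟩,
      fun h => leftFormula_of_eq_mul _ _ _ _ (fun m n => (n : ℤ))
      (fun m n => by ring) (.inl (by norm_num)) fun m n => ⟨_, fun Q hQ => by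
        simp only [H4, mul_assoc]
        exact (commute_poch_poch (hQ _ h.symm) _ _).symm.left_comm _⟩⟩
  · intro A B C _ _
    refine ⟨leftFormula_of_eq_mul _ _ _ _ (fun m n => 2 * (m : ℤ) + n)
      (fun m n => by ring) (.inl (by norm_num)) fun m n => ⟨_, fun Q _ => by simp only [H5, mul_assoc]; rfl⟩,
      fun hZ h => leftFormula_of_eq_mul _ _ _ _ (fun m n => (n : ℤ) - m)
      (fun m n => by ring) (.inr hZ) fun m n => ⟨_, fun Q hQ => by
        simp only [H5, mul_assoc]
        exact (commute_poch_poch (hQ _ h.symm) _ _).symm.left_comm _⟩⟩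
  · intro A B C _ _
    refine ⟨fun hZ => leftFormula_of_eq_mul _ _ _ _ (fun m n => 2 * (m : ℤ) - n)
      (fun m n => by ring) (.inr hZ) fun m n => ⟨_, fun Q _ => by simp only [H6, mul_assoc]; rfl⟩,
      fun hZ h => leftFormula_of_eq_mul _ _ _ _ (fun m n => (n : ℤ) - m)
      (fun m n => by ring) (.inr hZ) fun m n => ⟨_, fun Q hQ => by
        simp only [H6, mul_assoc]
        exact (commute_poch_poch (hQ _ h.symm) _ _).symm.left_comm _⟩⟩
  · intro A B C C' _ _
    refine ⟨fun hZ => leftFormula_of_eq_mul _ _ _ _ (fun m n => 2 * (m : ℤ) - n)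
      (fun m n => by ring) (.inr hZ) fun m n => ⟨_, fun Q _ => by simp only [H7, mul_assoc]; rfl⟩,
      fun h => leftFormula_of_eq_mul _ _ _ _ (fun m n => (n : ℤ))
      (fun m n => by ring) (.inl (by norm_num)) fun m n => ⟨_, fun Q hQ => by
        simp only [H7, mul_assoc]
        exact (commute_poch_poch (hQ _ h.symm) _ _).symm.left_comm _⟩,
      fun h => rightFormula_of_eq_mul _ _ _ _ (fun m n => (n : ℤ))
      (fun m n => by ring) (.inl (by norm_num)) fun m n => ⟨_, fun Q hQ => (commute_poch_poch_inv (hQ _ h) _ _).right_comm _⟩⟩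
  · intro A B B' _ _
    refine ⟨leftFormula_of_eq_mul _ _ _ _ (fun m n => (m : ℤ))
      (fun m n => by ring) (.inl (by norm_num)) fun m n => ⟨_, fun Q _ => by simp only [Gamma1, mul_assoc]; rfl⟩,
      fun hZ h => rightFormula_of_eq_mul _ _ _ _ (fun m n => (n : ℤ) - m)
      (fun m n => by ring) (.inr hZ) fun m n => ⟨_, fun Q hQ => (commute_poch_poch (hQ _ h) _ _).right_comm _⟩,
      fun hZ => rightFormula_of_eq_mul _ _ _ _ (fun m n => (m : ℤ) - n)
      (fun m n => by ring) (.inr hZ) fun m n => ⟨_, fun Q _ => rfl⟩⟩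
  · intro B B' _ _
    refine ⟨fun hZ => leftFormula_of_eq_mul _ _ _ _ (fun m n => (n : ℤ) - m)
      (fun m n => by ring) (.inr hZ) fun m n => ⟨_, fun Q _ => rfl⟩,
      fun hZ => rightFormula_of_eq_mul _ _ _ _ (fun m n => (m : ℤ) - n)
      (fun m n => by ring) (.inr hZ) fun m n => ⟨_, fun Q _ => rfl⟩⟩
  · intro A B C _ _
    refine ⟨fun hZ => leftFormula_of_eq_mul _ _ _ _ (fun m n => (m : ℤ) - n)
      (fun m n => by ring) (.inr hZ) fun m n => ⟨_, fun Q _ => by simp only [calH1, mul_assoc]; rfl⟩,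
      fun h => leftFormula_of_eq_mul _ _ _ _ (fun m n => (m : ℤ) + n)
      (fun m n => by ring) (.inl (by norm_num)) fun m n => ⟨_, fun Q hQ => by
        simp only [calH1, mul_assoc]
        exact (commute_poch_poch (hQ _ h.symm) _ _).symm.left_comm _⟩⟩
  · intro A B B' C _ _
    refine ⟨fun hZ => leftFormula_of_eq_mul _ _ _ _ (fun m n => (m : ℤ) - n)
      (fun m n => by ring) (.inr hZ) fun m n => ⟨_, fun Q _ => by simp only [calH2, mul_assoc]; rfl⟩,
      fun h => leftFormula_of_eq_mul _ _ _ _ (fun m n => (m : ℤ))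
      (fun m n => by ring) (.inl (by norm_num)) fun m n => ⟨_, fun Q hQ => by
        simp only [calH2, mul_assoc]
        exact (commute_poch_poch (hQ _ h.symm) _ _).symm.left_comm _⟩,
      fun h => rightFormula_of_eq_mul _ _ _ _ (fun m n => (n : ℤ))
      (fun m n => by ring) (.inl (by norm_num)) fun m n => ⟨_, fun Q hQ => (commute_poch_poch_inv (hQ _ h) _ _).right_comm _⟩⟩
  · intro A B C _ _
    refine ⟨fun hZ => leftFormula_of_eq_mul _ _ _ _ (fun m n => (m : ℤ) - n)
      (fun m n => by ring) (.inr hZ) fun m n => ⟨_, fun Q _ => by simp only [calH3, mul_assoc]; rfl⟩,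
      fun h => leftFormula_of_eq_mul _ _ _ _ (fun m n => (m : ℤ))
      (fun m n => by ring) (.inl (by norm_num)) fun m n => ⟨_, fun Q hQ => by
        simp only [calH3, mul_assoc]
        exact (commute_poch_poch (hQ _ h.symm) _ _).symm.left_comm _⟩⟩
  · intro A B' C _ _
    refine ⟨fun hZ => leftFormula_of_eq_mul _ _ _ _ (fun m n => (m : ℤ) - n)
      (fun m n => by ring) (.inr hZ) fun m n => ⟨_, fun Q _ => by simp only [calH4, mul_assoc]; rfl⟩,
      fun h => leftFormula_of_eq_mul _ _ _ _ (fun m n => (n : ℤ))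
      (fun m n => by ring) (.inl (by norm_num)) fun m n => ⟨_, fun Q hQ => by
        simp only [calH4, mul_assoc]
        exact (commute_poch_poch (hQ _ h.symm) _ _).symm.left_comm _⟩⟩
  · intro A C
    exact fun hZ _ => leftFormula_of_eq_mul _ _ _ _ (fun m n => (m : ℤ) - n)
      (fun m n => by ring) (.inr hZ) fun m n => ⟨_, fun Q _ => rfl⟩
  · intro A C _
    exact leftFormula_of_eq_mul _ _ _ _ (fun m n => 2 * (m : ℤ) + n)
      (fun m n => by ring) (.inl (by norm_num)) fun m n => ⟨_, fun Q _ => rfl⟩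
  · intro A C C' _ _
    exact leftFormula_of_eq_mul _ _ _ _ (fun m n => 2 * (m : ℤ) + n)
      (fun m n => by ring) (.inl (by norm_num)) fun m n => ⟨_, fun Q _ => by simp only [calH7, mul_assoc]; rfl⟩
  · intro A B _ _
    refine ⟨fun hZ => leftFormula_of_eq_mul _ _ _ _ (fun m n => 2 * (m : ℤ) - n)
      (fun m n => by ring) (.inr hZ) fun m n => ⟨_, fun Q _ => rfl⟩,
      fun hZ => rightFormula_of_eq_mul _ _ _ _ (fun m n => (n : ℤ) - m)
      (fun m n => by ring) (.inr hZ) fun m n => ⟨_, fun Q _ => rfl⟩⟩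
  · intro A B C _ _
    refine ⟨fun hZ => leftFormula_of_eq_mul _ _ _ _ (fun m n => 2 * (m : ℤ) - n)
      (fun m n => by ring) (.inr hZ) fun m n => ⟨_, fun Q _ => by simp only [calH9, mul_assoc]; rfl⟩,
      fun h => leftFormula_of_eq_mul _ _ _ _ (fun m n => (n : ℤ))
      (fun m n => by ring) (.inl (by norm_num)) fun m n => ⟨_, fun Q hQ => by
        simp only [calH9, mul_assoc]
        exact (commute_poch_poch (hQ _ h.symm) _ _).symm.left_comm _⟩⟩
  · intro A C
    exact fun hZ _ => leftFormula_of_eq_mul _ _ _ _ (fun m n => 2 * (m : ℤ) - n)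
      (fun m n => by ring) (.inr hZ) fun m n => ⟨_, fun Q _ => rfl⟩
  · intro A B C C' _ _
    refine ⟨fun hZ => leftFormula_of_eq_mul _ _ _ _ (fun m n => (m : ℤ) - n)
      (fun m n => by ring) (.inr hZ) fun m n => ⟨_, fun Q _ => by simp only [calH11, mul_assoc]; rfl⟩,
      fun h => leftFormula_of_eq_mul _ _ _ _ (fun m n => (n : ℤ))
      (fun m n => by ring) (.inl (by norm_num)) fun m n => ⟨_, fun Q hQ => by
        simp only [calH11, mul_assoc]
        exact (commute_poch_poch (hQ _ h.symm) _ _).symm.left_comm _⟩,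
      fun h => rightFormula_of_eq_mul _ _ _ _ (fun m n => (n : ℤ))
      (fun m n => by ring) (.inl (by norm_num)) fun m n => ⟨_, fun Q hQ => (commute_poch_poch_inv (hQ _ h) _ _).right_comm _⟩⟩
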